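/- A (finite, simple) hypergraph $H$ consists of a finite vertex set $V(H)$ and a set $E(H)$ of distinct subsets of $V(H)$, called edges. It is $k$-uniform if every edge has exactly $k$ vertices, and $d$-regular if every vertex lies in exactly $d$ edges; $\delta(H)$ denotes the minimum degree, i.e. the least number of edges containing a given vertex. We say that $H$ has the MMS (Manickam–Miklós–Singhi) property if for every function $f:V(H)\to\mathbb{R}$ with $\sum_{v\in V(H)} f(v)\ge 0$ there are at least $\delta(H)$ edges $e\in E(H)$ with $\sum_{v\in e} f(v)\ge 0$. Let $p\ge 11$ be a prime and let $m\ge 1$ be an integer. Then for every even integer $d$ with $$4\le d\le (p-1)\binom{p}{2}^{m-1}$$ there exists a $2m$-uniform $d$-regular hypergraph on $mp$ vertices with the MMS property. -/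

import Mathlib

namespace Hypergraph

/-- The number of edges of `H` that contain the vertex `v`. -/
noncomputable def degree {α : Type*} (H : Hypergraph α) (v : α) : ℕ :=
  {e | e ∈ H.edgeSet ∧ v ∈ e}.ncard

/-- The minimum degree `δ(H)`: the least degree of a vertex of `H`
(it is `0` if `H` has no vertices). -/
noncomputable def minDegree {α : Type*} (H : Hypergraph α) : ℕ :=
  sInf (H.degree '' H.vertexSet)

/-- Every vertex of `H` lies in exactly `d` edges. -/
def IsRegular {α : Type*} (H : Hypergraph α) (d : ℕ) : Prop :=
  ∀ v ∈ H.vertexSet, H.degree v = d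

/-- Every edge of `H` has exactly `k` vertices. -/
def IsUniform {α : Type*} (H : Hypergraph α) (k : ℕ) : Prop :=
  ∀ e ∈ H.edgeSet, e.ncard = k

/-- The Manickam–Miklós–Singhi property of a finite hypergraph: every weighting of the vertices
by real numbers with nonnegative total has at least `δ(H)` edges of nonnegative weight. -/
def HasMMSProperty {α : Type*} [Finite α] (H : Hypergraph α) : Prop :=
  ∀ f : α → ℝ, 0 ≤ ∑ᶠ v ∈ H.vertexSet, f v →
    H.minDegree ≤ {e | e ∈ H.edgeSet ∧ 0 ≤ ∑ᶠ v ∈ e, f v}.ncard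

end Hypergraph

/-! Put `p = 2 * q + 1` and split the vertices into `m` fibres `ZMod p`. A choice of slopes in `1,
…, q` and offsets on all fibres but one partitions the vertices into `p` transversals indexed by
`x`; its edges are the unions of transversals `x` and `x + s` with `1 ≤ s ≤ t ≤ q`. With `g x` the
weight of transversal `x`, which has nonnegative total, the MMS bound for one family says that a
circulant graph has at least `2 * t` nonnegative edges (`two_mul_le_sum_nonnegCount`).

Each step gives a Hamiltonian cycle with at least one nonnegative edge. If one cycle has only one,
the weights at every second vertex along it are nonnegative, which forces at least 2 such edges on
every other cycle and at least 3 on all but one of these. So `t ≥ 2` suffices. Distinct families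
share no edges (`transversalEdge_slope_inj`), so their degrees `2 * t` add up to any even `d ≥ 4`
within the bound. -/

theorem natCast_zmod_ne_zero {p n : ℕ} (h0 : 0 < n) (hn : n < p) : (n : ZMod p) ≠ 0 := by
  rw [Ne, ZMod.natCast_eq_zero_iff]
  exact fun h => absurd (Nat.le_of_dvd h0 h) (by omega)

theorem natCast_zmod_inj {p k l : ℕ} (hk : k < p) (hl : l < p) (h : (k : ZMod p) = l) : k = l := by
  have := congrArg ZMod.val h
  rwa [ZMod.val_natCast_of_lt hk, ZMod.val_natCast_of_lt hl] at this

/-! ### Nonnegative edges of circulant graphs -/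

/-- The number of edges `{x, x + s}` of the circulant graph with step `s` on which `g` is
nonnegative. -/
noncomputable def nonnegCount {p : ℕ} [NeZero p] (g : ZMod p → ℝ) (s : ZMod p) : ℕ :=
  (Finset.univ.filter fun x => 0 ≤ g x + g (x + s)).card

theorem nonnegCount_neg {p : ℕ} [NeZero p] (g : ZMod p → ℝ) (s : ZMod p) :
    nonnegCount g (-s) = nonnegCount g s := by
  unfold nonnegCount
  refine Finset.card_bij' (fun x _ => x - s) (fun x _ => x + s) ?_ ?_ ?_ ?_
  · intro x hx
    simp only [Finset.mem_filter, Finset.mem_univ, true_and] at hx ⊢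
    rw [sub_add_cancel, add_comm, sub_eq_add_neg]; exact hx
  · intro x hx
    simp only [Finset.mem_filter, Finset.mem_univ, true_and] at hx ⊢
    rw [add_neg_cancel_right, add_comm]; exact hx
  · intro x _; simp
  · intro x _; simp

theorem nonnegCount_comp_mul {p : ℕ} [Fact p.Prime] (g : ZMod p → ℝ) {s : ZMod p} (hs : s ≠ 0)
    (u : ZMod p) : nonnegCount (fun x => g (s * x)) u = nonnegCount g (s * u) := by
  unfold nonnegCount
  refine Finset.card_bij (fun x _ => s * x) ?_ ?_ ?_
  · intro x hx
    simpa [mul_add] using hx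
  · intro x _ y _ h
    exact mul_left_cancel₀ hs h
  · intro y hy
    have hy' : s * (s⁻¹ * y) = y := by rw [← mul_assoc, mul_inv_cancel₀ hs, one_mul]
    refine ⟨s⁻¹ * y, ?_, hy'⟩
    simp only [Finset.mem_filter, Finset.mem_univ, true_and] at hy ⊢
    rw [mul_add, hy']; exact hy

theorem one_le_nonnegCount {p : ℕ} [NeZero p] (g : ZMod p → ℝ) (hg : 0 ≤ ∑ x, g x)
    (s : ZMod p) : 1 ≤ nonnegCount g s := by
  have h : 0 ≤ ∑ x, (g x + g (x + s)) := by
    have := Equiv.sum_comp (Equiv.addRight s) g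
    rw [Equiv.coe_addRight] at this
    rw [Finset.sum_add_distrib, this]
    linarith
  obtain ⟨x, -, hx⟩ := Finset.exists_le_of_sum_le (s := Finset.univ)
    (f := fun _ : ZMod p => (0 : ℝ))
    (g := fun x => g x + g (x + s)) Finset.univ_nonempty (by simpa using h)
  exact Finset.card_pos.2 ⟨x, by simpa using hx⟩

theorem sum_range_two_mul_nonpos {h : ℕ → ℝ} {n : ℕ}
    (hneg : ∀ i, i + 1 < 2 * n → h i + h (i + 1) ≤ 0) : ∑ i ∈ Finset.range (2 * n), h i ≤ 0 := by
  induction n with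
  | zero => simp
  | succ n ih =>
    rw [show 2 * (n + 1) = 2 * n + 1 + 1 by ring, Finset.sum_range_succ, Finset.sum_range_succ]
    have := ih fun i hi => hneg i (by omega)
    have := hneg (2 * n) (by omega)
    linarith

theorem sum_zmod_eq_sum_range {p : ℕ} [NeZero p] (g : ZMod p → ℝ) (c : ZMod p) :
    ∑ x, g x = ∑ i ∈ Finset.range p, g (c + i) := by
  symm
  refine Finset.sum_bij (fun i _ => c + (i : ZMod p)) (by simp) ?_ ?_ (by simp)
  · intro i hi j hj h
    rw [Finset.mem_range] at hi hj
    exact natCast_zmod_inj hi hj (add_left_cancel h)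
  · intro x _
    exact ⟨(x - c).val, Finset.mem_range.2 (ZMod.val_lt _), by simp⟩

/-- If only one edge of an odd cycle is nonnegative, then every second vertex of the cycle,
counted from an end of that edge, has nonnegative weight. -/
theorem exists_alternating_nonneg {p q : ℕ} [NeZero p] (hpq : p = 2 * q + 1) (g : ZMod p → ℝ)
    (hg : 0 ≤ ∑ x, g x) (h1 : nonnegCount g 1 ≤ 1) :
    ∃ c : ZMod p, ∀ k ≤ q, 0 ≤ g (c + 2 * (k : ZMod p)) := by
  obtain ⟨c, hc⟩ : ∃ c : ZMod p, ∀ x, x + 1 ≠ c → g x + g (x + 1) < 0 := by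
    obtain ⟨b, hb⟩ := Finset.card_le_one_iff_subset_singleton.1 h1
    refine ⟨b + 1, fun x hx => ?_⟩
    by_contra! hn
    have : x ∈ ({b} : Finset (ZMod p)) := hb (by simpa using hn)
    rw [Finset.mem_singleton] at this
    exact hx (by rw [this])
  have hneg : ∀ i : ℕ, i + 1 < p → g (c + i) + g (c + (i + 1 : ℕ)) ≤ 0 := by
    intro i hi
    have := hc (c + i) (by
      rw [add_assoc, Ne, add_eq_left]
      intro h
      exact natCast_zmod_ne_zero i.succ_pos hi (by push_cast; exact h))
    rw [add_assoc] at this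
    push_cast
    exact this.le
  refine ⟨c, fun k hk => ?_⟩
  -- Deleting `c + 2k` from the path starting at `c` leaves paths on `2k` and `2(q - k)` vertices,
  -- each perfectly matched by edges of nonpositive weight.
  have hp : Finset.range p = Finset.range (2 * k + (1 + 2 * (q - k))) := by
    congr 1; omega
  rw [sum_zmod_eq_sum_range g c, hp, Finset.sum_range_add, Finset.sum_range_add] at hg
  have hA := sum_range_two_mul_nonpos (h := fun i : ℕ => g (c + i)) (n := k)
    fun i hi => hneg i (by omega)
  have hB := sum_range_two_mul_nonpos (h := fun i : ℕ => g (c + (2 * k + (1 + i) : ℕ))) (n := q - k)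
    fun i hi => hneg (2 * k + (1 + i)) (by omega)
  simp only [Finset.sum_range_one] at hg
  push_cast at hg hA hB
  rw [add_zero] at hg
  linarith

/-- The vertices with parameters `k` and `k + u` are both nonnegative for each `k ≤ q - u`. -/
theorem nonnegCount_ge_of_alternating {p q : ℕ} [NeZero p] (hpq : p = 2 * q + 1)
    (g : ZMod p → ℝ) (c : ZMod p) (hc : ∀ k ≤ q, 0 ≤ g (c + 2 * (k : ZMod p))) (u : ℕ)
    (hu : u ≤ q) : q + 1 - u ≤ nonnegCount g (2 * u) := by
  rw [← Finset.card_range (q + 1 - u)]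
  refine Finset.card_le_card_of_injOn (fun k => c + 2 * (k : ZMod p)) ?_ ?_
  · intro k hk
    simp only [Finset.coe_range, Set.mem_Iio] at hk
    simp only [Finset.coe_filter, Finset.mem_univ, true_and, Set.mem_ofPred_eq]
    have h1 := hc k (by omega)
    have h2 := hc (k + u) (by omega)
    push_cast at h2
    rw [add_assoc, ← mul_add]
    exact add_nonneg h1 h2
  · intro k hk l hl h
    simp only [Finset.coe_range, Set.mem_Iio] at hk hl
    have h' : ((2 * k : ℕ) : ZMod p) = (2 * l : ℕ) := by
      push_cast; exact add_left_cancel h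
    have := natCast_zmod_inj (by omega) (by omega) h'
    omega

theorem exists_eq_two_mul_natCast {p q : ℕ} [Fact p.Prime] (hpq : p = 2 * q + 1) (s : ZMod p) :
    ∃ u ≤ q, s = 2 * (u : ZMod p) ∨ s = -(2 * (u : ZMod p)) := by
  have h2 : (2 : ZMod p) * (q + 1) = 1 := by
    have : ((2 * q + 1 : ℕ) : ZMod p) = 0 := by rw [← hpq]; simp
    push_cast at this
    linear_combination this
  set t : ZMod p := (q + 1) * s with ht
  have hs : s = 2 * t := by rw [ht, ← mul_assoc, h2, one_mul]
  refine ⟨t.valMinAbs.natAbs, ?_, ?_⟩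
  · have := ZMod.natAbs_valMinAbs_le t
    omega
  · have h : ((t.valMinAbs : ℤ) : ZMod p) = t := ZMod.coe_valMinAbs t
    rcases Int.natAbs_eq t.valMinAbs with h' | h'
    · left
      rw [h'] at h
      rw [hs, ← Int.cast_natCast, h]
    · right
      rw [h'] at h
      rw [Int.cast_neg, neg_eq_iff_eq_neg] at h
      rw [hs, ← Int.cast_natCast, h, mul_neg, neg_neg]

/-- Writing `s = ±2u` gives at least `q + 1 - u` edges. Modulo `p`, `2q = -1` and `2(q - 1) = -3`,
so `u = q` and `u = q - 1` are exactly the exceptional steps `±1` and `±3`. -/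
theorem nonnegCount_ge_of_nonnegCount_one_le_one {p q : ℕ} [Fact p.Prime] (hpq : p = 2 * q + 1)
    (hq : 2 ≤ q) (g : ZMod p → ℝ) (hg : 0 ≤ ∑ x, g x) (h1 : nonnegCount g 1 ≤ 1) (s : ZMod p)
    (hs : s ≠ 1) (hs' : s ≠ -1) :
    2 ≤ nonnegCount g s ∧ (s ≠ 3 → s ≠ -3 → 3 ≤ nonnegCount g s) := by
  obtain ⟨c, hc⟩ := exists_alternating_nonneg hpq g hg h1
  obtain ⟨u, hu, hsu⟩ := exists_eq_two_mul_natCast hpq s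
  have hN : nonnegCount g s = nonnegCount g (2 * u) := by
    rcases hsu with rfl | rfl
    · rfl
    · exact nonnegCount_neg _ _
  have hge := nonnegCount_ge_of_alternating hpq g c hc u hu
  have hp : ((2 * q + 1 : ℕ) : ZMod p) = 0 := by rw [← hpq]; simp
  push_cast at hp
  have huq : u ≠ q := by
    rintro rfl
    rcases hsu with h | h
    · exact hs' (by linear_combination h + hp)
    · exact hs (by linear_combination h - hp)
  refine ⟨by omega, fun h3 h3' => ?_⟩
  have huq' : u + 1 ≠ q := by
    rintro rfl
    push_cast at hp
    rcases hsu with h | h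
    · exact h3' (by linear_combination h + hp)
    · exact h3 (by linear_combination h - hp)
  omega

theorem nonnegCount_ge_of_nonnegCount_le_one {p q : ℕ} [Fact p.Prime] (hpq : p = 2 * q + 1)
    (hq : 2 ≤ q) (g : ZMod p → ℝ) (hg : 0 ≤ ∑ x, g x) {s : ZMod p} (hs0 : s ≠ 0)
    (h1 : nonnegCount g s ≤ 1) (s' : ZMod p) (hs : s' ≠ s) (hs' : s' ≠ -s) :
    2 ≤ nonnegCount g s' ∧ (s' ≠ 3 * s → s' ≠ -(3 * s) → 3 ≤ nonnegCount g s') := by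
  have hmul : s * (s⁻¹ * s') = s' := by rw [← mul_assoc, mul_inv_cancel₀ hs0, one_mul]
  have key := nonnegCount_ge_of_nonnegCount_one_le_one hpq hq (fun x => g (s * x))
    (hg.trans_eq (Equiv.sum_comp (Equiv.mulLeft₀ s hs0) g).symm)
    (by rw [nonnegCount_comp_mul g hs0, mul_one]; exact h1) (s⁻¹ * s')
    (fun h => hs (by rw [← hmul, h, mul_one]))
    (fun h => hs' (by rw [← hmul, h, mul_neg_one]))
  rw [nonnegCount_comp_mul g hs0, hmul] at key
  exact ⟨key.1, fun h3 h3' => key.2 (fun h => h3 (by rw [← hmul, h, mul_comm]))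
    (fun h => h3' (by rw [← hmul, h]; ring))⟩

/-- The circulant graph on `ZMod p` with steps `1, …, t` has at least `2 * t` nonnegative edges. -/
theorem two_mul_le_sum_nonnegCount {p q : ℕ} [Fact p.Prime] (hpq : p = 2 * q + 1)
    (hq : 5 ≤ q) (g : ZMod p → ℝ) (hg : 0 ≤ ∑ x, g x) (t : ℕ) (ht : 2 ≤ t) (htq : t ≤ q) :
    2 * t ≤ ∑ s ∈ Finset.Icc 1 t, nonnegCount g s := by
  have hcard : 2 * t = ∑ s ∈ Finset.Icc 1 t, 2 := by simp [mul_comm]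
  by_cases hall : ∀ s ∈ Finset.Icc 1 t, 2 ≤ nonnegCount g (s : ZMod p)
  · rw [hcard]
    exact Finset.sum_le_sum hall
  push Not at hall
  obtain ⟨s, hs, hs1⟩ := hall
  rw [Finset.mem_Icc] at hs
  have hs0 := natCast_zmod_ne_zero (p := p) (n := s) (by omega) (by omega)
  have hsne : ∀ s' ∈ Finset.Icc 1 t, s' ≠ s →
      (s' : ZMod p) ≠ (s : ZMod p) ∧ (s' : ZMod p) ≠ -(s : ZMod p) := by
    intro s' hs' hne'
    rw [Finset.mem_Icc] at hs'
    refine ⟨fun h => hne' ?_, fun h =>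
      natCast_zmod_ne_zero (p := p) (n := s' + s) (by omega) (by omega) ?_⟩
    · exact natCast_zmod_inj (by omega) (by omega) h
    · push_cast; rw [h]; ring
  have hge := fun (s' : ℕ) hs' hne' => nonnegCount_ge_of_nonnegCount_le_one hpq (by omega) g hg hs0
    (by omega) (s' : ZMod p) (hsne s' hs' hne').1 (hsne s' hs' hne').2
  -- One of the steps 1 and 2 makes up for the deficit at `s`. The primes 2, 3, 5, 7 must be
  -- excluded to rule out coincidences with `±3s`.
  obtain ⟨s', hs', hne', h3⟩ : ∃ s' ∈ Finset.Icc 1 t, s' ≠ s ∧ 3 ≤ nonnegCount g (s' : ZMod p) := by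
    have h1 : (1 : ZMod p) ≠ 0 := one_ne_zero
    have h3 : (3 : ZMod p) ≠ 0 := by
      exact_mod_cast natCast_zmod_ne_zero (p := p) (n := 3) (by omega) (by omega)
    have h5 : (5 : ZMod p) ≠ 0 := by
      exact_mod_cast natCast_zmod_ne_zero (p := p) (n := 5) (by omega) (by omega)
    have h7 : (7 : ZMod p) ≠ 0 := by
      exact_mod_cast natCast_zmod_ne_zero (p := p) (n := 7) (by omega) (by omega)
    have m1 : 1 ∈ Finset.Icc 1 t := by simp; omega
    have m2 : 2 ∈ Finset.Icc 1 t := by simp; omega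
    by_cases e1 : 1 = s
    · refine ⟨2, m2, by omega, (hge 2 m2 (by omega)).2 ?_ ?_⟩
      · rw [← e1]; push_cast; intro h; exact h1 (by linear_combination -h)
      · rw [← e1]; push_cast; intro h; exact h5 (by linear_combination h)
    by_cases e2 : 2 = s
    · refine ⟨1, m1, by omega, (hge 1 m1 (by omega)).2 ?_ ?_⟩
      · rw [← e2]; push_cast; intro h; exact h5 (by linear_combination -h)
      · rw [← e2]; push_cast; intro h; exact h7 (by linear_combination h)
    by_cases e : (1 : ZMod p) = 3 * s ∨ (1 : ZMod p) = -(3 * s)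
    · refine ⟨2, m2, e2, (hge 2 m2 e2).2 ?_ ?_⟩
      · push_cast; intro h
        rcases e with e | e
        · exact h1 (by linear_combination h - e)
        · exact h3 (by linear_combination h + e)
      · push_cast; intro h
        rcases e with e | e
        · exact h3 (by linear_combination h + e)
        · exact h1 (by linear_combination h - e)
    · push Not at e
      exact ⟨1, m1, e1, (hge 1 m1 e1).2 (by simpa using e.1) (by simpa using e.2)⟩
  have hsm : s ∈ Finset.Icc 1 t := Finset.mem_Icc.2 hs
  have hs'm : s' ∈ (Finset.Icc 1 t).erase s := Finset.mem_erase.2 ⟨hne', hs'⟩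
  have hrest : ∑ x ∈ ((Finset.Icc 1 t).erase s).erase s', 2 ≤
      ∑ x ∈ ((Finset.Icc 1 t).erase s).erase s', nonnegCount g (x : ZMod p) := by
    refine Finset.sum_le_sum fun x hx => ?_
    rw [Finset.mem_erase, Finset.mem_erase] at hx
    exact (hge x hx.2.2 hx.2.1).1
  have hone := one_le_nonnegCount g hg (s : ZMod p)
  rw [hcard, ← Finset.add_sum_erase _ _ hsm, ← Finset.add_sum_erase _ _ hs'm,
    ← Finset.add_sum_erase _ (fun x : ℕ => nonnegCount g (x : ZMod p)) hsm,
    ← Finset.add_sum_erase _ (fun x : ℕ => nonnegCount g (x : ZMod p)) hs'm]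
  omega

/-! ### Distributing the degree among the families -/

/-- A number `t ≠ 1` of size at most `q * #S` splits into `#S` parts of size at most `q`,
none of which is `1`. -/
theorem exists_sum_eq_of_le_mul_card {ι : Type*} [DecidableEq ι] {q : ℕ} (hq : 3 ≤ q)
    (S : Finset ι) (t : ℕ) (ht : t ≠ 1) (htq : t ≤ q * S.card) :
    ∃ T : ι → ℕ, (∀ i, T i ≠ 1 ∧ T i ≤ q) ∧ ∑ i ∈ S, T i = t := by
  induction S using Finset.induction_on generalizing t with
  | empty => exact ⟨fun _ => 0, by simp, by simp at htq; simp [htq]⟩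
  | insert a S ha ih =>
    rw [Finset.card_insert_of_notMem ha, mul_add, mul_one] at htq
    obtain ⟨r, hr1, hrq, hrt, h1, hle⟩ :
        ∃ r, r ≠ 1 ∧ r ≤ q ∧ r ≤ t ∧ t - r ≠ 1 ∧ t - r ≤ q * S.card := by
      rcases le_or_gt t q with h | h
      · exact ⟨t, ht, h, le_rfl, by omega, by omega⟩
      · by_cases h' : t = q + 1
        -- Taking `q` would leave the forbidden remainder 1; this leaves 2.
        · refine ⟨q - 1, by omega, by omega, by omega, by omega, ?_⟩
          have : q * 1 ≤ q * S.card := Nat.mul_le_mul_left _ (by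
            by_contra h0
            rw [show S.card = 0 by omega] at htq
            omega)
          omega
        · exact ⟨q, by omega, le_rfl, by omega, by omega, by omega⟩
    obtain ⟨T, hT, hsum⟩ := ih (t - r) h1 hle
    refine ⟨Function.update T a r, fun i => ?_, ?_⟩
    · by_cases hi : i = a
      · subst hi; simp [hr1, hrq]
      · simpa [Function.update_of_ne hi] using hT i
    · rw [Finset.sum_insert ha, Function.update_self, Finset.sum_congr rfl fun i hi =>
        Function.update_of_ne (ne_of_mem_of_not_mem hi ha) r T, hsum]
      omega

/-! ### Edges built from transversals -/

/-- The union of the transversals `{(i, a i * x + y i)}` and `{(i, a i * (x + s) + y i)}` of the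
fibres of `ι × ZMod p`. -/
def transversalEdge {p : ℕ} {ι : Type*} (a y : ι → ZMod p) (s x : ZMod p) : Set (ι × ZMod p) :=
  {v | v.2 = a v.1 * x + y v.1 ∨ v.2 = a v.1 * (x + s) + y v.1}

section TransversalEdge

variable {p : ℕ} {ι : Type*}

theorem mk_mem_transversalEdge {a y : ι → ZMod p} {s x : ZMod p} {i : ι} {w : ZMod p} :
    (i, w) ∈ transversalEdge a y s x ↔ w = a i * x + y i ∨ w = a i * (x + s) + y i :=
  Iff.rfl

theorem transversalEdge_eq_union_range (a y : ι → ZMod p) (s x : ZMod p) :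
    transversalEdge a y s x =
      Set.range (fun i => (i, a i * x + y i)) ∪ Set.range (fun i => (i, a i * (x + s) + y i)) := by
  ext ⟨i, w⟩
  simp [mk_mem_transversalEdge, eq_comm]

theorem disjoint_range_transversal [Fact p.Prime] {a y : ι → ZMod p} {s : ZMod p}
    (ha : ∀ i, a i ≠ 0) (hs : s ≠ 0) (x : ZMod p) :
    Disjoint (Set.range fun i => (i, a i * x + y i))
      (Set.range fun i => (i, a i * (x + s) + y i)) := by
  rw [Set.disjoint_left]
  rintro _ ⟨i, rfl⟩ ⟨j, h⟩
  simp only [Prod.mk.injEq] at h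
  obtain ⟨rfl, h⟩ := h
  exact mul_ne_zero (ha j) hs (by linear_combination h)

theorem transversal_injective (b : ι → ZMod p) : Function.Injective fun i => (i, b i) :=
  fun _ _ h => congrArg Prod.fst h

theorem ncard_transversalEdge [Finite ι] [Fact p.Prime] {a y : ι → ZMod p} {s : ZMod p}
    (ha : ∀ i, a i ≠ 0) (hs : s ≠ 0) (x : ZMod p) :
    (transversalEdge a y s x).ncard = 2 * Nat.card ι := by
  rw [transversalEdge_eq_union_range, Set.ncard_union_eq (disjoint_range_transversal ha hs x),
    Set.ncard_range_of_injective (transversal_injective _),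
    Set.ncard_range_of_injective (transversal_injective _), two_mul]

theorem finsum_mem_transversalEdge [Fintype ι] [Fact p.Prime] {a y : ι → ZMod p} {s : ZMod p}
    (ha : ∀ i, a i ≠ 0) (hs : s ≠ 0) (x : ZMod p) (f : ι × ZMod p → ℝ) :
    ∑ᶠ v ∈ transversalEdge a y s x, f v =
      ∑ i, f (i, a i * x + y i) + ∑ i, f (i, a i * (x + s) + y i) := by
  rw [transversalEdge_eq_union_range, finsum_mem_union (disjoint_range_transversal ha hs x)
    (Set.toFinite _) (Set.toFinite _), finsum_mem_range (transversal_injective _),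
    finsum_mem_range (transversal_injective _), finsum_eq_sum_of_fintype, finsum_eq_sum_of_fintype]

theorem sum_sum_transversal [Fintype ι] [Fact p.Prime] {a : ι → ZMod p} (y : ι → ZMod p)
    (ha : ∀ i, a i ≠ 0) (f : ι × ZMod p → ℝ) :
    ∑ x, ∑ i, f (i, a i * x + y i) = ∑ v, f v := by
  rw [Finset.sum_comm, Fintype.sum_prod_type]
  refine Finset.sum_congr rfl fun i _ => ?_
  exact Equiv.sum_comp ((Equiv.mulLeft₀ (a i) (ha i)).trans (Equiv.addRight (y i)))
    fun w => f (i, w)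

open Classical in
theorem card_filter_mem_transversalEdge [Fact p.Prime] {a y : ι → ZMod p} {s : ZMod p}
    (ha : ∀ i, a i ≠ 0) (hs : s ≠ 0) (v : ι × ZMod p) :
    (Finset.univ.filter fun x => v ∈ transversalEdge a y s x).card = 2 := by
  obtain ⟨i, w⟩ := v
  have hai := ha i
  have : (Finset.univ.filter fun x => (i, w) ∈ transversalEdge a y s x) =
      {(w - y i) / a i, (w - y i) / a i - s} := by
    ext x
    simp only [mk_mem_transversalEdge, Finset.mem_filter, Finset.mem_univ, true_and,
      Finset.mem_insert, Finset.mem_singleton, eq_sub_iff_add_eq, eq_div_iff hai]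
    refine or_congr ⟨fun h => ?_, fun h => ?_⟩ ⟨fun h => ?_, fun h => ?_⟩ <;>
      linear_combination -h
  rw [this, Finset.card_pair]
  exact fun h => hs (by linear_combination h)

end TransversalEdge

/-- The slopes `(1, r₁ + 1, …, rₙ + 1)` of a family of transversals. -/
def transversalSlope (p : ℕ) {q n : ℕ} (j : Fin n → Fin q × ZMod p) : Fin (n + 1) → ZMod p :=
  Fin.cons 1 fun i => (((j i).1 + 1 : ℕ) : ZMod p)

/-- The offsets `(0, y₁, …, yₙ)` of a family of transversals. -/
def transversalOffset {p q n : ℕ} (j : Fin n → Fin q × ZMod p) : Fin (n + 1) → ZMod p :=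
  Fin.cons 0 fun i => (j i).2

theorem transversalSlope_ne_zero {p q n : ℕ} [Fact p.Prime] (hpq : p = 2 * q + 1)
    (j : Fin n → Fin q × ZMod p) (i : Fin (n + 1)) : transversalSlope p j i ≠ 0 := by
  refine Fin.cases ?_ (fun i => ?_) i
  · simp [transversalSlope]
  · simp only [transversalSlope, Fin.cons_succ]
    exact natCast_zmod_ne_zero (by omega) (by omega)

/-- Fibre 0, with slope 1 and offset 0, shows the pair `{x, x + s}`; since `s + s' ≠ 0`, it
determines `s` and `x`. On any other fibre, exchanging the two points would negate the slope,
impossible for slopes in `1, …, q`. -/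
theorem transversalEdge_slope_inj {p q n : ℕ} [Fact p.Prime] (hpq : p = 2 * q + 1)
    {j j' : Fin n → Fin q × ZMod p} {s s' : ℕ} {x x' : ZMod p} (hs : 0 < s) (hsq : s ≤ q)
    (hs' : 0 < s') (hsq' : s' ≤ q)
    (h : transversalEdge (transversalSlope p j) (transversalOffset j) s x =
      transversalEdge (transversalSlope p j') (transversalOffset j') s' x') :
    j = j' ∧ s = s' ∧ x = x' := by
  have hmem := fun i w => Set.ext_iff.1 h (i, w)
  simp only [mk_mem_transversalEdge] at hmem
  have hs0 : (s : ZMod p) ≠ 0 := natCast_zmod_ne_zero hs (by omega)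
  have hss : (s : ZMod p) + s' ≠ 0 := by
    rw [← Nat.cast_add]; exact natCast_zmod_ne_zero (p := p) (n := s + s') (by omega) (by omega)
  have h0 : s = s' ∧ x = x' := by
    have h1 := (hmem 0 x).1 (by simp [transversalSlope, transversalOffset])
    have h2 := (hmem 0 (x + s)).1 (by simp [transversalSlope, transversalOffset])
    simp only [transversalSlope, transversalOffset, Fin.cons_zero, one_mul, add_zero] at h1 h2
    rcases h1 with h1 | h1 <;> rcases h2 with h2 | h2
    · exact absurd (by linear_combination h2 - h1) hs0
    · exact ⟨natCast_zmod_inj (p := p) (k := s) (l := s') (by omega) (by omega)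
        (by linear_combination h2 - h1), h1⟩
    · exact absurd (by linear_combination h2 - h1) hss
    · exact absurd (by linear_combination h2 - h1) hs0
  obtain ⟨rfl, rfl⟩ := h0
  refine ⟨funext fun i => ?_, rfl, rfl⟩
  have h1 := (hmem i.succ _).1 (Or.inl rfl)
  have h2 := (hmem i.succ _).1 (Or.inr rfl)
  have ha := transversalSlope_ne_zero hpq j i.succ
  simp only [transversalSlope, transversalOffset, Fin.cons_succ] at h1 h2 ha
  have hss : (((j i).1 + 1 : ℕ) : ZMod p) + (((j' i).1 + 1 : ℕ) : ZMod p) ≠ 0 := by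
    rw [← Nat.cast_add]; exact natCast_zmod_ne_zero (by omega) (by omega)
  have key : (((j i).1 + 1 : ℕ) : ZMod p) = (((j' i).1 + 1 : ℕ) : ZMod p) ∧
      (j i).2 = (j' i).2 := by
    rcases h1 with h1 | h1 <;> rcases h2 with h2 | h2
    · exact absurd (by linear_combination h2 - h1) (mul_ne_zero ha hs0)
    · have e := mul_right_cancel₀ hs0 (by linear_combination h2 - h1 :
        (((j i).1 + 1 : ℕ) : ZMod p) * s = (((j' i).1 + 1 : ℕ) : ZMod p) * s)
      exact ⟨e, by linear_combination h1 - x * e⟩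
    · exact absurd (by linear_combination h2 - h1) (mul_ne_zero hss hs0)
    · exact absurd (by linear_combination h2 - h1) (mul_ne_zero ha hs0)
  refine Prod.ext (Fin.ext ?_) key.2
  have := natCast_zmod_inj (by omega) (by omega) key.1
  omega

/-! ### The hypergraph and its properties -/

/-- Indices of the chosen edges: `T j` step lengths for each family `j` of transversals. -/
def edgeIndices {p q n : ℕ} [NeZero p] (T : (Fin n → Fin q × ZMod p) → ℕ) :
    Finset (Σ _ : Fin n → Fin q × ZMod p, ℕ × ZMod p) :=
  Finset.univ.sigma fun j => Finset.Icc 1 (T j) ×ˢ Finset.univ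

/-- The edge with a given index, transported along `e`. -/
def indexedEdge {p q n : ℕ} {α : Type*} (e : Fin (n + 1) × ZMod p ≃ α)
    (t : Σ _ : Fin n → Fin q × ZMod p, ℕ × ZMod p) : Set α :=
  e '' transversalEdge (transversalSlope p t.1) (transversalOffset t.1) t.2.1 t.2.2

theorem injOn_indexedEdge {p q n : ℕ} [Fact p.Prime] (hpq : p = 2 * q + 1) {α : Type*}
    (e : Fin (n + 1) × ZMod p ≃ α) {T : (Fin n → Fin q × ZMod p) → ℕ} (hT : ∀ j, T j ≤ q) :
    Set.InjOn (indexedEdge e) (edgeIndices T : Set (Σ _ : Fin n → Fin q × ZMod p, ℕ × ZMod p)) := by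
  rintro ⟨j, s, x⟩ ht ⟨j', s', x'⟩ ht' h
  simp only [edgeIndices, Finset.mem_coe, Finset.mem_sigma, Finset.mem_univ, true_and,
    Finset.mem_product, Finset.mem_Icc, and_true] at ht ht'
  obtain ⟨rfl, rfl, rfl⟩ := transversalEdge_slope_inj hpq ht.1 (ht.2.trans (hT j)) ht'.1
    (ht'.2.trans (hT j')) (e.injective.image_injective h)
  rfl

open Classical in
theorem ncard_setOf_mem_image_indexedEdge {p q n : ℕ} [Fact p.Prime] (hpq : p = 2 * q + 1)
    {α : Type*} (e : Fin (n + 1) × ZMod p ≃ α) {T : (Fin n → Fin q × ZMod p) → ℕ}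
    (hT : ∀ j, T j ≤ q) (P : Set α → Prop) :
    {E | (∃ t ∈ edgeIndices T, indexedEdge e t = E) ∧ P E}.ncard =
      ∑ j, ∑ s ∈ Finset.Icc 1 (T j),
        (Finset.univ.filter fun x => P (indexedEdge e ⟨j, s, x⟩)).card := by
  have : {E | (∃ t ∈ edgeIndices T, indexedEdge e t = E) ∧ P E} =
      indexedEdge (q := q) e '' ((edgeIndices T).filter fun t => P (indexedEdge e t)) := by
    ext E
    constructor
    · rintro ⟨⟨t, ht, rfl⟩, hP⟩
      exact ⟨t, by simpa using ⟨ht, hP⟩, rfl⟩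
    · rintro ⟨t, ht, rfl⟩
      rw [Finset.mem_coe, Finset.mem_filter] at ht
      exact ⟨⟨t, ht.1, rfl⟩, ht.2⟩
  rw [this, ((injOn_indexedEdge hpq e hT).mono
      (Finset.coe_subset.2 (Finset.filter_subset _ _))).ncard_image,
    Set.ncard_coe_finset, Finset.card_filter, edgeIndices, Finset.sum_sigma]
  refine Finset.sum_congr rfl fun j _ => ?_
  rw [Finset.sum_product]
  refine Finset.sum_congr rfl fun s _ => ?_
  rw [Finset.card_filter]

/-- The hypergraph whose edges are the transported transversal edges with index in
`edgeIndices T`. -/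
def transversalHypergraph {p q n : ℕ} [NeZero p] {α : Type*} (e : Fin (n + 1) × ZMod p ≃ α)
    (T : (Fin n → Fin q × ZMod p) → ℕ) : Hypergraph α where
  vertexSet := Set.univ
  edgeSet := {E | ∃ t ∈ edgeIndices T, indexedEdge e t = E}
  subset_vertexSet_of_mem_edgeSet' _ _ := Set.subset_univ _

section TransversalHypergraph

variable {p q n : ℕ} [Fact p.Prime] {α : Type*} (e : Fin (n + 1) × ZMod p ≃ α)
  {T : (Fin n → Fin q × ZMod p) → ℕ}

theorem transversalHypergraph_isUniform (hpq : p = 2 * q + 1) (hT : ∀ j, T j ≤ q) :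
    (transversalHypergraph e T).IsUniform (2 * (n + 1)) := by
  rintro _ ⟨⟨j, s, x⟩, ht, rfl⟩
  simp only [edgeIndices, Finset.mem_sigma, Finset.mem_univ, true_and,
    Finset.mem_product, Finset.mem_Icc, and_true] at ht
  have := hT j
  have hs : (s : ZMod p) ≠ 0 := natCast_zmod_ne_zero (by omega) (by omega)
  rw [indexedEdge, Set.ncard_image_of_injective _ e.injective,
    ncard_transversalEdge (transversalSlope_ne_zero hpq j) hs,
    Nat.card_fin]

theorem transversalHypergraph_degree (hpq : p = 2 * q + 1) (hT : ∀ j, T j ≤ q) (v : α) :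
    (transversalHypergraph e T).degree v = 2 * ∑ j, T j := by
  classical
  obtain ⟨w, rfl⟩ := e.surjective v
  refine (ncard_setOf_mem_image_indexedEdge hpq e hT fun E => e w ∈ E).trans ?_
  rw [Finset.mul_sum]
  refine Finset.sum_congr rfl fun j _ => ?_
  rw [Finset.sum_congr rfl (g := fun _ => 2), Finset.sum_const, Nat.card_Icc, smul_eq_mul,
    Nat.add_sub_cancel, mul_comm]
  intro s hs
  rw [Finset.mem_Icc] at hs
  have := hT j
  simp only [indexedEdge, e.injective.mem_set_image]
  exact card_filter_mem_transversalEdge (transversalSlope_ne_zero hpq j)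
    (natCast_zmod_ne_zero (by omega) (by omega)) w

theorem transversalHypergraph_hasMMSProperty [Finite α] (hpq : p = 2 * q + 1) (hq : 5 ≤ q)
    (hT : ∀ j, T j ≠ 1 ∧ T j ≤ q) : (transversalHypergraph e T).HasMMSProperty := by
  classical
  intro f hf
  have hTq := fun j => (hT j).2
  have hmin : (transversalHypergraph e T).minDegree ≤ 2 * ∑ j, T j :=
    Nat.sInf_le ⟨e (0, 0), Set.mem_univ _, transversalHypergraph_degree e hpq hTq _⟩
  have hsum : 0 ≤ ∑ v, f (e v) := by
    rw [← finsum_eq_sum_of_fintype, finsum_comp_equiv e]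
    simpa [transversalHypergraph] using hf
  refine hmin.trans (le_of_le_of_eq ?_
    (ncard_setOf_mem_image_indexedEdge hpq e hTq fun E => 0 ≤ ∑ᶠ v ∈ E, f v).symm)
  rw [Finset.mul_sum]
  refine Finset.sum_le_sum fun j _ => ?_
  -- An empty family needs nothing; otherwise `T j ≥ 2`, as the circulant bound requires.
  rcases Nat.eq_zero_or_pos (T j) with h0 | h0
  · simp [h0]
  have h1 := (hT j).1
  refine (two_mul_le_sum_nonnegCount hpq hq
    (fun x => ∑ i, f (e (i, transversalSlope p j i * x + transversalOffset j i))) ?_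
    (T j) (by omega) (hTq j)).trans_eq ?_
  · rw [sum_sum_transversal (transversalOffset j) (transversalSlope_ne_zero hpq j) fun v => f (e v)]
    exact hsum
  · refine Finset.sum_congr rfl fun s hs => ?_
    rw [Finset.mem_Icc] at hs
    have := hTq j
    have hs : (s : ZMod p) ≠ 0 := natCast_zmod_ne_zero (by omega) (by omega)
    unfold nonnegCount
    congr 1
    refine Finset.filter_congr fun x _ => ?_
    rw [indexedEdge, finsum_mem_image e.injective.injOn,
      finsum_mem_transversalEdge (transversalSlope_ne_zero hpq j) hs x fun v => f (e v)]

end TransversalHypergraph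

theorem mainTheorem10 (p : ℕ) (hp : p.Prime) (hp11 : 11 ≤ p) (m : ℕ) (hm : 1 ≤ m)
    (d : ℕ) (hd : Even d) (hd4 : 4 ≤ d) (hdle : d ≤ (p - 1) * (p.choose 2) ^ (m - 1)) :
    ∃ H : Hypergraph (Fin (m * p)), H.vertexSet = Set.univ ∧
      H.IsUniform (2 * m) ∧ H.IsRegular d ∧ H.HasMMSProperty := by
  have : Fact p.Prime := ⟨hp⟩
  obtain ⟨q, hpq⟩ : ∃ q, p = 2 * q + 1 := hp.odd_of_ne_two (by omega)
  obtain ⟨n, rfl⟩ : ∃ n, m = n + 1 := ⟨m - 1, by omega⟩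
  obtain ⟨t, rfl⟩ := hd
  -- `q * p` counts the slope–offset pairs on one fibre, so there are `(p.choose 2) ^ n` families,
  -- each of degree at most `2 * q = p - 1`.
  have hchoose : p.choose 2 = q * p := by
    rw [Nat.choose_two_right, show p - 1 = 2 * q by omega, Nat.div_eq_of_eq_mul_left two_pos]
    ring
  have hcard : t ≤ q * (Finset.univ : Finset (Fin n → Fin q × ZMod p)).card := by
    rw [Finset.card_univ, Fintype.card_fun, Fintype.card_prod, Fintype.card_fin, Fintype.card_fin,
      ZMod.card]
    rw [hchoose, Nat.add_sub_cancel, show p - 1 = 2 * q by omega, mul_assoc] at hdle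
    omega
  obtain ⟨T, hT, hsum⟩ := exists_sum_eq_of_le_mul_card (by omega) _ t (by omega) hcard
  have hTq := fun j => (hT j).2
  let e : Fin (n + 1) × ZMod p ≃ Fin ((n + 1) * p) :=
    Fintype.equivOfCardEq (by simp [ZMod.card])
  refine ⟨transversalHypergraph e T, rfl, transversalHypergraph_isUniform e hpq hTq,
    fun v _ => ?_, transversalHypergraph_hasMMSProperty e hpq (by omega) hT⟩
  rw [transversalHypergraph_degree e hpq hTq, hsum, two_mul]
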